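/- **Theorem 6.** For $\mathbf x=(x,y)^\top\in\mathbb R^2$ write $x=r\cos\theta$, $y=r\sin\theta$, $r=\sqrt{x^2+y^2}$, let $\rho(\theta)=\begin{pmatrix}\cos\theta&-\sin\theta\\ \sin\theta&\cos\theta\end{pmatrix}$, and let $P_n^{(a,b)}$ be the Jacobi polynomials in the standard normalisation $P_n^{(a,b)}(1)=\frac{(a+1)_n}{n!}$, where $(c)_n=c(c+1)\cdots(c+n-1)$. For $m\in\mathbb Z$ and $j\ge 0$ let $$w_{mj}(\mathbf x)=(1-r^2)\,P_j^{(1,|m|)}(2r^2-1)\,(x+i\,\mathrm{sign}(m)\,y)^{|m|}$$ be the weighted generalised Zernike polynomials. For $n\ge 0$ and real $b\ge 0$ put $$\mathfrak r_n^{(b)}=10n^2+n(13b+19)+4(b+1)(b+2),$$ $$\mathbf v_n^{(b)}(t)=\begin{pmatrix}(b+1)(1-t)P_n^{(1,b+1)}(2t-1)-2t(n+1)P_n^{(0,b+2)}(2t-1)\\ (b+1)P_n^{(1,b+1)}(2t-1)\end{pmatrix},$$ $$\mathbf q_n^{(b),1}(t)=\frac{2n+b+1}{(n+1)\mathfrak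 r_n^{(b)}}\left[(2n+b+2)(2n+b+3)P_n^{(1,b)}(2t-1)\begin{pmatrix}1-t\\1\end{pmatrix}-(n+b+2)\mathbf v_n^{(b)}(t)\right],$$ $$\mathbf q_n^{(b),2}(t)=-\tfrac1n\mathbf v_{n-1}^{(b)}(t)-\mathbf q_n^{(b),1}(t)\quad(n\ge1).$$ For $j\ge1$ define $$\mathbf v_{0j}^{N,1}=P_{j-1}^{(0,1)}(2r^2-1)\begin{pmatrix}x\\y\end{pmatrix},\qquad \mathbf v_{0j}^{N,2}=P_{j-1}^{(1,1)}(2r^2-1)\begin{pmatrix}-y\\x\end{pmatrix},$$ and, for $m\ne0$ and $\nu=1,2$, $$\mathbf v_{mj}^{N,\nu}=r^{|m|-1}e^{im\theta}\rho(\theta)\begin{pmatrix}1&0\\0&i\,\mathrm{sign}(m)\end{pmatrix}\mathbf q_j^{(|m|-1),\nu}(r^2).$$ With $N(x,y)=\begin{pmatrix}1-y^2&xy\\xy&1-x^2\end{pmatrix}$ put $\mathbf n_{mj}^{\nu}=N\,\mathbf v_{mj}^{N,\nu}$, and let $\mathbf n_{0j}^+=2\mathbf n_{0j}^1$ and $\mathbf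 n_{mj}^+=\mathbf n_{mj}^1+\mathbf n_{mj}^2$ for $m\neq0$. Then for all $m\in\mathbb Z$ and all $j\ge0$, at every point of $\mathbb R^2$ (in particular on the closed unit disk), $$\nabla w_{mj}=-(j+1)\,\mathbf n_{m,j+1}^+ ,\qquad \nabla=(\partial_x,\partial_y)^\top .$$ -/

import Mathlib

namespace DiskZernike

noncomputable section

/-- The real plane, with its Euclidean norm; `p 0 = x`, `p 1 = y` and `‖p‖ = r`. -/
abbrev Plane : Type := EuclideanSpace ℝ (Fin 2)

/-- The Jacobi polynomial
`P_n^{(a,b)}(x) = ∑_{l=0}^n (n+a+b+1)_l (a+l+1)_{n-l} / (l! (n-l)!) * ((x-1)/2)^l`,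
with `(c)_l` the rising factorial (the standard normalisation, `P_n^{(a,b)}(1) = (a+1)_n / n!`). -/
def jacobiP (n : ℕ) (a b : ℝ) : Polynomial ℝ :=
  ∑ l ∈ Finset.range (n + 1),
    Polynomial.C ((ascPochhammer ℝ l).eval (n + a + b + 1) *
        (ascPochhammer ℝ (n - l)).eval (a + l + 1) / (l.factorial * (n - l).factorial)) *
      (Polynomial.C (1 / 2) * (Polynomial.X - 1)) ^ l

/-- `P_n^{(a,b)}(2t-1)`. -/
def shiftedJacobi (n : ℕ) (a b t : ℝ) : ℝ :=
  (jacobiP n a b).eval (2 * t - 1)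

/-- `sign m` as a complex number. -/
def sgn (m : ℤ) : ℂ := (m.sign : ℂ)

/-- The harmonic polynomial `y_m = (x + sign(m) i y)^{|m|}`. -/
def harmonicY (m : ℤ) (p : Plane) : ℂ :=
  ((p 0 : ℂ) + sgn m * Complex.I * (p 1 : ℂ)) ^ m.natAbs

/-- The generalised Zernike polynomial `z_{mj}^{(lam)} = P_j^{(lam,|m|)}(2r²-1) y_m`. -/
def zernike (lam : ℝ) (m : ℤ) (j : ℕ) (p : Plane) : ℂ :=
  (shiftedJacobi j lam m.natAbs (‖p‖ ^ 2) : ℂ) * harmonicY m p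

/-- The weighted Zernike polynomial `w_{mj} = (1-r²) z_{mj}^{(1)}`. -/
def weightedZernike (m : ℤ) (j : ℕ) (p : Plane) : ℂ :=
  (1 - (‖p‖ : ℂ) ^ 2) * zernike 1 m j p

/-- The gradient `(∂_x f, ∂_y f)` of a complex-valued function on the plane. -/
def gradC (f : Plane → ℂ) (p : Plane) : Fin 2 → ℂ :=
  fun i => fderiv ℝ f p (EuclideanSpace.single i 1)

/-- The constant `𝔯_n^{(b)} = 10n² + n(13b+19) + 4(b+1)(b+2)`. -/
def rConst (n : ℕ) (b : ℝ) : ℝ :=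
  10 * (n : ℝ) ^ 2 + n * (13 * b + 19) + 4 * (b + 1) * (b + 2)

/-- The univariate vector polynomial `v_n^{(b)}(t)`. -/
def vAux (n : ℕ) (b t : ℝ) : Fin 2 → ℝ :=
  ![(b + 1) * (1 - t) * shiftedJacobi n 1 (b + 1) t
      - 2 * t * (n + 1) * shiftedJacobi n 0 (b + 2) t,
    (b + 1) * shiftedJacobi n 1 (b + 1) t]

/-- The univariate vector polynomial `q_n^{(b),1}(t)`. -/
def qOne (n : ℕ) (b t : ℝ) : Fin 2 → ℝ :=
  ((2 * n + b + 1) / ((n + 1) * rConst n b)) •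
    (((2 * n + b + 2) * (2 * n + b + 3) * shiftedJacobi n 1 b t) • ![1 - t, 1]
      - (n + b + 2) • vAux n b t)

/-- The univariate vector polynomial `q_n^{(b),2}(t)` for `n ≥ 1`; by convention
`q_0^{(b),2} = 0`. -/
def qTwo : (n : ℕ) → (b t : ℝ) → Fin 2 → ℝ
  | 0, _, _ => 0
  | n + 1, b, t => -((1 / ((n + 1 : ℕ) : ℝ)) • vAux n b t) - qOne (n + 1) b t

/-- The polar angle `θ` of a point (the value at the origin, where it is immaterial, is `0`). -/
def polarAngle (p : Plane) : ℝ :=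
  Complex.arg (⟨p 0, p 1⟩ : ℂ)

/-- The rotation matrix `ρ(φ)`. -/
def rot (φ : ℝ) : Matrix (Fin 2) (Fin 2) ℂ :=
  !![(Real.cos φ : ℂ), -(Real.sin φ : ℂ); (Real.sin φ : ℂ), (Real.cos φ : ℂ)]

/-- For `m ≠ 0`, the map
`𝒫_m f = r^{|m|-1} e^{imθ} ρ(θ) diag(1, i sign m) f(r²)` from univariate vector polynomials to
vector functions on the plane. -/
def liftMode (m : ℤ) (f : ℝ → Fin 2 → ℝ) (p : Plane) : Fin 2 → ℂ :=
  ((‖p‖ : ℂ) ^ (m.natAbs - 1) * Complex.exp (Complex.I * m * polarAngle p)) •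
    (rot (polarAngle p)).mulVec
      ((Matrix.diagonal ![1, Complex.I * sgn m]).mulVec
        (fun i => ((f (‖p‖ ^ 2) i : ℝ) : ℂ)))

/-- The vector field `r e_r = (x, y)`. -/
def rER (p : Plane) : Fin 2 → ℂ := ![(p 0 : ℂ), (p 1 : ℂ)]

/-- The vector field `r e_θ = (-y, x)`. -/
def rETheta (p : Plane) : Fin 2 → ℂ := ![-(p 1 : ℂ), (p 0 : ℂ)]

/-- The vector orthogonal polynomial `v_{mj}^{N,1}`; for `m = 0` it is meant for `j ≥ 1`. -/
def vNOne (m : ℤ) (j : ℕ) (p : Plane) : Fin 2 → ℂ :=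
  if m = 0 then (shiftedJacobi (j - 1) 0 1 (‖p‖ ^ 2) : ℂ) • rER p
  else liftMode m (qOne j ((m.natAbs : ℝ) - 1)) p

/-- The vector orthogonal polynomial `v_{mj}^{N,2}`, meant for `j ≥ 1`. -/
def vNTwo (m : ℤ) (j : ℕ) (p : Plane) : Fin 2 → ℂ :=
  if m = 0 then (shiftedJacobi (j - 1) 1 1 (‖p‖ ^ 2) : ℂ) • rETheta p
  else liftMode m (qTwo j ((m.natAbs : ℝ) - 1)) p

/-- The matrix weight `N(x,y)`, which makes vectors normal at the unit circle. -/
def weightN (p : Plane) : Matrix (Fin 2) (Fin 2) ℂ :=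
  !![1 - (p 1 : ℂ) ^ 2, (p 0 : ℂ) * (p 1 : ℂ);
     (p 0 : ℂ) * (p 1 : ℂ), 1 - (p 0 : ℂ) ^ 2]

/-- `n_{mj}^1 = N v_{mj}^{N,1}`. -/
def nOne (m : ℤ) (j : ℕ) (p : Plane) : Fin 2 → ℂ :=
  (weightN p).mulVec (vNOne m j p)

/-- `n_{mj}^2 = N v_{mj}^{N,2}`. -/
def nTwo (m : ℤ) (j : ℕ) (p : Plane) : Fin 2 → ℂ :=
  (weightN p).mulVec (vNTwo m j p)

/-- For `j ≥ 1`: `n_{0j}^+ = 2 n_{0j}^1`, and `n_{mj}^+ = n_{mj}^1 + n_{mj}^2` for `m ≠ 0`. -/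
def nPlus (m : ℤ) (j : ℕ) (p : Plane) : Fin 2 → ℂ :=
  if m = 0 then (2 : ℂ) • nOne m j p else nOne m j p + nTwo m j p

end

end DiskZernike

namespace DiskZernike

/-! In the polar frame, `w` is `e^{imθ}` times a function of `r`. Its radial derivative follows from
the product rule and `((1-t) P_j^{(1,b)}(2t-1))' = -(j+1) P_j^{(0,b+1)}(2t-1)`; its angular
derivative keeps the factor `1 - r²`. Since `N` fixes `e_r` and scales `e_θ` by `1 - r²`, the
gradient is `N` applied to the lift of `v_j`. In `q¹ + q²` the `q¹` terms cancel, leaving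
`-v_j/(j+1)` at index `j+1`. For `m = 0` only the radial part survives. -/

open Polynomial in
/-- Raising the weight: `d/dt [(1 - t) P_n^{(1,b)}(2t - 1)] = -(n + 1) P_n^{(0,b+1)}(2t - 1)`. -/
theorem hasDerivAt_one_sub_mul_shiftedJacobi (n : ℕ) (b t : ℝ) :
    HasDerivAt (fun t => (1 - t) * shiftedJacobi n 1 b t)
      (-((n + 1 : ℝ) * shiftedJacobi n 0 (b + 1) t)) t := by
  have expand : ∀ a b t : ℝ, shiftedJacobi n a b t = ∑ l ∈ Finset.range (n + 1),
      (ascPochhammer ℝ l).eval (n + a + b + 1) * (ascPochhammer ℝ (n - l)).eval (a + l + 1)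
        / (l.factorial * (n - l).factorial) * (t - 1) ^ l := by
    intro a b t
    simp only [shiftedJacobi, jacobiP, eval_finsetSum, eval_mul, eval_C, eval_pow, eval_sub,
      eval_X, eval_one]
    refine Finset.sum_congr rfl fun l _ => ?_
    congr 2
    ring
  have hfun : (fun t => (1 - t) * shiftedJacobi n 1 b t) = fun t => ∑ l ∈ Finset.range (n + 1),
      -((ascPochhammer ℝ l).eval (n + 1 + b + 1) * (ascPochhammer ℝ (n - l)).eval (1 + l + 1 : ℝ)
        / (l.factorial * (n - l).factorial)) * (t - 1) ^ (l + 1) := by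
    funext t
    rw [expand, Finset.mul_sum]
    refine Finset.sum_congr rfl fun l _ => ?_
    ring
  rw [hfun, expand, Finset.mul_sum, ← Finset.sum_neg_distrib]
  refine HasDerivAt.fun_sum fun l hl => ?_
  have hl' : l ≤ n := Nat.lt_succ_iff.mp (Finset.mem_range.mp hl)
  -- Both sides equal `(l+1)_{n-l+1}`: one splits off its first factor, the other its last.
  have hpoch : (l + 1 : ℝ) * (ascPochhammer ℝ (n - l)).eval (1 + l + 1 : ℝ)
      = (n + 1) * (ascPochhammer ℝ (n - l)).eval (0 + l + 1 : ℝ) := by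
    have h1 := ascPochhammer_succ_eval (S := ℝ) (n - l) (l + 1)
    have h2 : (ascPochhammer ℝ (n - l + 1)).eval (l + 1 : ℝ)
        = (l + 1) * (ascPochhammer ℝ (n - l)).eval (l + 1 + 1 : ℝ) := by
      rw [ascPochhammer_succ_left]
      simp [eval_comp]
    rw [h2, Nat.cast_sub hl'] at h1
    rw [show (1 + l + 1 : ℝ) = l + 1 + 1 by ring, h1, zero_add]
    ring
  have hd := (((hasDerivAt_id t).sub_const 1).fun_pow (l + 1)).const_mul
    (-((ascPochhammer ℝ l).eval (n + 1 + b + 1) * (ascPochhammer ℝ (n - l)).eval (1 + l + 1 : ℝ)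
        / (l.factorial * (n - l).factorial)))
  refine hd.congr_deriv ?_
  simp only [id, Nat.add_sub_cancel, mul_one, Nat.cast_add, Nat.cast_one]
  rw [show (n + 0 + (b + 1) + 1 : ℝ) = n + 1 + b + 1 by ring]
  linear_combination (-((ascPochhammer ℝ l).eval (n + 1 + b + 1)
    / (l.factorial * (n - l).factorial) * (t - 1) ^ l)) * hpoch

theorem norm_sq_eq (p : Plane) : ‖p‖ ^ 2 = p 0 ^ 2 + p 1 ^ 2 := by
  simp [EuclideanSpace.norm_sq_eq]

/-- The total derivative of `w_{mj}`, in Cartesian coordinates. -/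
theorem hasFDerivAt_weightedZernike (m : ℤ) (j : ℕ) (p : Plane) :
    ∃ L : Plane →L[ℝ] ℂ, HasFDerivAt (weightedZernike m j) L p ∧ ∀ v : Plane,
      L v = -(2 * ((j : ℂ) + 1) * shiftedJacobi j 0 (m.natAbs + 1) (‖p‖ ^ 2))
            * (p 0 * v 0 + p 1 * v 1) * harmonicY m p
          + (1 - (‖p‖ : ℂ) ^ 2) * shiftedJacobi j 1 m.natAbs (‖p‖ ^ 2)
            * (m.natAbs * (p 0 + sgn m * Complex.I * p 1) ^ (m.natAbs - 1)
              * (v 0 + sgn m * Complex.I * v 1)) := by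
  have hx (i : Fin 2) : HasFDerivAt (fun q : Plane => q i)
      (EuclideanSpace.proj i : Plane →L[ℝ] ℝ) p :=
    (EuclideanSpace.proj i : Plane →L[ℝ] ℝ).hasFDerivAt
  have hxC (i : Fin 2) := Complex.ofRealCLM.hasFDerivAt.comp p (hx i)
  -- Differentiating `x² + y²` instead of the norm makes the origin an ordinary point.
  have hr := (HasFDerivAt.pow (hx 0) 2).fun_add (HasFDerivAt.pow (hx 1) 2)
  have hf := (hasDerivAt_one_sub_mul_shiftedJacobi j m.natAbs (p 0 ^ 2 + p 1 ^ 2)).comp_hasFDerivAt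
    p hr
  have hfC := Complex.ofRealCLM.hasFDerivAt.comp p hf
  have hY := HasFDerivAt.pow
    ((hxC 0).fun_add ((hxC 1).const_mul (sgn m * Complex.I))) m.natAbs
  have hw := hfC.fun_mul hY
  have heq : weightedZernike m j = fun q : Plane => (Complex.ofRealCLM ∘
      (fun t => (1 - t) * shiftedJacobi j 1 m.natAbs t) ∘ fun q : Plane => q 0 ^ 2 + q 1 ^ 2) q
      * ((Complex.ofRealCLM ∘ fun q : Plane => q 0) q
        + sgn m * Complex.I * (Complex.ofRealCLM ∘ fun q : Plane => q 1) q) ^ m.natAbs := by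
    funext q
    simp only [weightedZernike, zernike, harmonicY, Function.comp, Complex.ofRealCLM_apply,
      ← Complex.ofReal_pow, norm_sq_eq]
    push_cast
    ring
  refine ⟨_, heq ▸ hw, fun v => ?_⟩
  simp [harmonicY, ← Complex.ofReal_pow, norm_sq_eq]
  ring

/-- De Moivre, via `m = sign(m)|m|`: it turns the exponential into a power that matches `harmonicY`.
-/
theorem exp_I_mul_eq_pow (m : ℤ) (φ : ℝ) : Complex.exp (Complex.I * m * φ)
    = (Real.cos φ + sgn m * Complex.I * Real.sin φ) ^ m.natAbs := by
  have hm : (m : ℂ) = sgn m * m.natAbs := by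
    have h := congrArg (Int.cast : ℤ → ℂ) (Int.sign_mul_natAbs m)
    rw [Int.cast_mul, Int.cast_natCast] at h
    exact h.symm
  rw [hm, show Complex.I * (sgn m * m.natAbs) * φ = m.natAbs * (sgn m * φ * Complex.I) by ring,
    Complex.exp_nat_mul]
  rcases lt_trichotomy m 0 with h | rfl | h
  · simp only [sgn, Int.sign_eq_neg_one_of_neg h, Complex.exp_mul_I]
    simp [mul_comm]
  · simp
  · simp only [sgn, Int.sign_eq_one_of_pos h, Complex.exp_mul_I]
    simp [mul_comm]

/-- `N = (1 - r²) I + p pᵀ`, so `p` is an eigenvector with eigenvalue `(1 - r²) + r² = 1`. -/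
theorem weightN_mulVec_rER (p : Plane) : (weightN p).mulVec (rER p) = rER p := by
  ext i
  fin_cases i <;> simp [weightN, rER, Matrix.mulVec, dotProduct, Fin.sum_univ_two] <;> ring

/-- `-(j+1) 𝐧⁺_{m,j+1} = N 𝒫_m 𝐯_j^{(|m|-1)}` for `m ≠ 0`. -/
theorem smul_nPlus_succ {m : ℤ} (hm : m ≠ 0) (j : ℕ) (p : Plane) :
    (-((j : ℂ) + 1)) • nPlus m (j + 1) p
      = (weightN p).mulVec (liftMode m (vAux j ((m.natAbs : ℝ) - 1)) p) := by
  have hj : (j : ℂ) + 1 ≠ 0 := by exact_mod_cast j.succ_ne_zero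
  simp only [nPlus, nOne, nTwo, vNOne, vNTwo, hm, if_false, liftMode, qTwo, ← Matrix.mulVec_add,
    ← Matrix.mulVec_smul, ← smul_add]
  rw [smul_comm]
  congr 4
  -- `qOne` stays folded: it cancels in the sum, so `rConst` never has to be nonzero.
  funext i
  simp only [Pi.smul_apply, Pi.add_apply, Pi.sub_apply, Pi.neg_apply, smul_eq_mul]
  push_cast
  field_simp
  ring

/-- Also true at the origin, where both sides vanish, so the main proof needs no case split there.
-/
theorem coord_eq_norm_mul (p : Plane) :
    p 0 = ‖p‖ * Real.cos (polarAngle p) ∧ p 1 = ‖p‖ * Real.sin (polarAngle p) := by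
  have hn : ‖p‖ = ‖(⟨p 0, p 1⟩ : ℂ)‖ := by
    rw [← sq_eq_sq₀ (norm_nonneg _) (norm_nonneg _), norm_sq_eq, Complex.sq_norm,
      Complex.normSq_mk]
    ring
  rw [hn, polarAngle, Complex.norm_mul_cos_arg, Complex.norm_mul_sin_arg]
  exact ⟨rfl, rfl⟩

end DiskZernike

open DiskZernike in
theorem theorem6 (m : ℤ) (j : ℕ) :
    Differentiable ℝ (DiskZernike.weightedZernike m j) ∧
    ∀ p : DiskZernike.Plane,
      DiskZernike.gradC (DiskZernike.weightedZernike m j) p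
        = (-((j : ℂ) + 1)) • DiskZernike.nPlus m (j + 1) p := by
  refine ⟨fun p => ?_, fun p => ?_⟩
  · obtain ⟨L, hL, -⟩ := hasFDerivAt_weightedZernike m j p
    exact hL.differentiableAt
  obtain ⟨L, hL, hLv⟩ := hasFDerivAt_weightedZernike m j p
  by_cases hm : m = 0
  · subst hm
    simp only [nPlus, nOne, vNOne, if_true, Matrix.mulVec_smul, weightN_mulVec_rER]
    ext i
    rw [gradC, hL.fderiv, hLv]
    fin_cases i <;> simp [harmonicY, rER] <;> ring
  · rw [smul_nPlus_succ hm]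
    obtain ⟨k, hk⟩ : ∃ k, m.natAbs = k + 1 :=
      Nat.exists_eq_succ_of_ne_zero (Int.natAbs_ne_zero.mpr hm)
    obtain ⟨h0, h1⟩ := coord_eq_norm_mul p
    have hs : sgn m ^ 2 = 1 := by
      rcases lt_or_gt_of_ne hm with h | h <;>
        simp [sgn, Int.sign_eq_neg_one_of_neg, Int.sign_eq_one_of_pos, h]
    have hcs : (Real.cos (polarAngle p) : ℂ) ^ 2 + (Real.sin (polarAngle p) : ℂ) ^ 2 = 1 := by
      exact_mod_cast Real.cos_sq_add_sin_sq (polarAngle p)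
    ext i
    rw [gradC, hL.fderiv, hLv, liftMode, exp_I_mul_eq_pow]
    simp only [harmonicY, hk, weightN, h0, h1, rot, vAux]
    -- With `b = |m| - 1`, the parameters `b + 1` and `b + 2` become `|m|` and `|m| + 1`, so the
    -- same two Jacobi values `A` and `B` occur on both sides.
    have hb : ((k + 1 : ℕ) : ℝ) - 1 + 2 = ((k + 1 : ℕ) : ℝ) + 1 := by ring
    simp only [hb, sub_add_cancel]
    generalize (shiftedJacobi j 1 _ _) = A
    generalize (shiftedJacobi j 0 _ _) = B
    push_cast only [Complex.ofReal_mul]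
    generalize (Real.cos (polarAngle p) : ℂ) = c at *
    generalize (Real.sin (polarAngle p) : ℂ) = s at *
    generalize sgn m = σ at *
    have hfac : ‖p‖ * c + σ * Complex.I * (‖p‖ * s) = ‖p‖ * (c + σ * Complex.I * s) := by ring
    have hI := Complex.I_sq
    rw [hfac]
    fin_cases i
    · simp [Matrix.vecHead, Matrix.vecTail]
      generalize (‖p‖ : ℂ) = R
      generalize Complex.I = ι at *
      simp only [mul_pow R]
      -- The `B` terms agree identically. For `A`, the first group encodes `(c + σιs)(c - σιs) = 1`,
      -- the last term `N e_θ = (1 - R²) e_θ`.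
      linear_combination (R ^ k * (c + σ * ι * s) ^ k * (k + 1) * A) *
        ((1 - R ^ 2) * (-hcs + s ^ 2 * σ ^ 2 * hI - s ^ 2 * hs)
          - (c + σ * ι * s) * ι * σ * s * R ^ 2 * hcs)
    · simp [Matrix.vecHead, Matrix.vecTail]
      generalize (‖p‖ : ℂ) = R
      generalize Complex.I = ι at *
      simp only [mul_pow R]
      linear_combination (R ^ k * (c + σ * ι * s) ^ k * (k + 1) * A) *
        ((1 - R ^ 2) * (-σ * ι * hcs - c * s * σ ^ 2 * hI + c * s * hs)
          + (c + σ * ι * s) * ι * σ * c * R ^ 2 * hcs)
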